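/- Let $n$ be a natural number. A proper cone in a finite-dimensional real vector space is a closed convex cone $K$ that is pointed ($K\cap(-K)=\{0\}$) and solid ($\operatorname{int}K\neq\emptyset$). A linear operator $B$ is positive with respect to $K$ if $B(K\setminus\{0\})\subseteq\operatorname{int}K$. Let $K_1\subset\mathbb R^n=\wedge^1\mathbb R^n,\ K_2\subset\wedge^2\mathbb R^n,\ \ldots,\ K_n\subset\wedge^n\mathbb R^n$ be proper cones (a totally positive structure on $\mathbb R^n$), and for $1\le j\le n$ put $$T(K_j)=\overline{\{x_1\in\mathbb R^n:\ \exists\,x_2,\ldots,x_j\in\mathbb R^n,\ x_1\wedge x_2\wedge\cdots\wedge x_j\in\operatorname{int}(K_j)\cup\operatorname{int}(-K_j)\}}\subseteq\mathbb R^n$$ (so that $T(K_1)=K_1\cup(-K_1)$). Let a linear operator $A:\mathbb R^n\to\mathbb R^n$ be generalized strictly sign-regular (GSSR) with respect to $\{K_1,\ldots,K_n\}$, i.e. there are $\epsilon_1,\ldots,\epsilon_n\in\{1,-1\}$ such that $\epsilon_j\wedge^jA$ is positive with respect to $K_j$ for every $j=1,\ldots,n$ (where $\wedge^1A=A$). Then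 for every $j=1,\ldots,n$ the interior of $T(K_j)$ is nonempty and $$A\bigl(T(K_j)\setminus\{0\}\bigr)\subseteq\operatorname{int}\bigl(T(K_j)\bigr).$$ -/

import Mathlib

open Set
open scoped Pointwise

noncomputable section

/-- The Euclidean space `ℝⁿ`. -/
abbrev Rn (n : ℕ) : Type := EuclideanSpace ℝ (Fin n)

/-- The `j`-th exterior power `∧ʲ ℝⁿ`. -/
abbrev ExtPow (n j : ℕ) : Type := ⋀[ℝ]^j (Rn n)

/-- The usual topology of the finite-dimensional real vector space `∧ʲ ℝⁿ`
(the one for which coordinates in any basis are a homeomorphism onto a coordinate space). -/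
instance ExtPow.topologicalSpace (n j : ℕ) : TopologicalSpace (ExtPow n j) :=
  moduleTopology ℝ (ExtPow n j)

instance ExtPow.isModuleTopology (n j : ℕ) : IsModuleTopology ℝ (ExtPow n j) := ⟨rfl⟩

instance ExtPow.isTopologicalAddGroup (n j : ℕ) : IsTopologicalAddGroup (ExtPow n j) :=
  IsModuleTopology.topologicalAddGroup ℝ (ExtPow n j)

/-- A proper cone in a real topological vector space: a closed convex cone `K` that is pointed
(`K ∩ (-K) = {0}`) and solid (`int K ≠ ∅`). -/
structure IsProperCone {V : Type*} [AddCommGroup V] [Module ℝ V] [TopologicalSpace V]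
    (K : Set V) : Prop where
  isClosed : IsClosed K
  add_mem : ∀ x ∈ K, ∀ y ∈ K, x + y ∈ K
  smul_mem : ∀ x ∈ K, ∀ α : ℝ, 0 ≤ α → α • x ∈ K
  pointed : K ∩ (-K) = {0}
  solid : (interior K).Nonempty

/-- `B` is positive with respect to `K`: `B (K \ {0}) ⊆ int K`. -/
def IsConePositive {V : Type*} [AddCommGroup V] [Module ℝ V] [TopologicalSpace V]
    (K : Set V) (B : V →ₗ[ℝ] V) : Prop :=
  B '' (K \ {0}) ⊆ interior K

/-- A totally positive structure on `ℝⁿ`: proper cones in `∧¹ ℝⁿ = ℝⁿ, ∧² ℝⁿ, …, ∧ⁿ ℝⁿ`.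
The cone in `∧ʲ ℝⁿ`, `1 ≤ j ≤ n`, has the index `j - 1` in `Fin n`. -/
structure TotallyPositiveStructure (n : ℕ) where
  cone : (i : Fin n) → Set (ExtPow n (i + 1))
  proper : ∀ i, IsProperCone (cone i)

/-- `A` is generalized strictly sign-regular with respect to `K`: there are signs `ε` such that
`ε_j (∧ʲ A)` is positive with respect to the cone in `∧ʲ ℝⁿ` for each `j = 1, …, n`. -/
def IsGSSR {n : ℕ} (K : TotallyPositiveStructure n) (A : Rn n →ₗ[ℝ] Rn n) : Prop :=
  ∃ ε : Fin n → ℝ, (∀ i, ε i = 1 ∨ ε i = -1) ∧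
    ∀ i : Fin n, IsConePositive (K.cone i) (ε i • exteriorPower.map ((i : ℕ) + 1) A)

/-- The exterior product `x₁ ∧ x₂ ∧ ⋯ ∧ x_{k+1}`, where `y` lists `x₂, …, x_{k+1}`. -/
def wedgeCons {n k : ℕ} (x₁ : Rn n) (y : Fin k → Rn n) : ExtPow n (k + 1) :=
  exteriorPower.ιMulti ℝ (k + 1) (Fin.cons x₁ y : Fin (k + 1) → Rn n)

/-- The set `T(K) ⊆ ℝⁿ` of a cone `K ⊆ ∧ʲ ℝⁿ`, `j = k + 1`: the closure of the set of all `x₁` for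
which there are `x₂, …, x_j` with `x₁ ∧ x₂ ∧ ⋯ ∧ x_j ∈ int K ∪ int (-K)`. -/
def coneT {n k : ℕ} (K : Set (ExtPow n (k + 1))) : Set (Rn n) :=
  closure {x₁ : Rn n | ∃ y : Fin k → Rn n, wedgeCons x₁ y ∈ interior K ∪ interior (-K)}

/-- In `∧¹ ℝⁿ = ℝⁿ` the set `T(K)` of a proper cone `K` is `K ∪ (-K)`. -/
theorem coneT_one {n : ℕ} {K : Set (ExtPow n 1)} (hK : IsProperCone K) :
    coneT (k := 0) K = (exteriorPower.oneEquiv ℝ (Rn n)) '' (K ∪ (-K)) := by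
  set e := exteriorPower.oneEquiv ℝ (Rn n)
  have he : ∀ (x : Rn n) (y : Fin 0 → Rn n), wedgeCons x y = e.symm x := by
    intro x y
    rw [LinearEquiv.eq_symm_apply]
    exact exteriorPower.oneEquiv_ιMulti _
  have : IsModuleTopology ℝ (Rn n) := isModuleTopologyOfFiniteDimensional
  let h : ExtPow n 1 ≃ₜ Rn n :=
    { e.toEquiv with
      continuous_toFun := IsModuleTopology.continuous_of_linearMap e.toLinearMap
      continuous_invFun := IsModuleTopology.continuous_of_linearMap e.symm.toLinearMap }
  have hcl : closure (interior K) = K := by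
    have hc : Convex ℝ K := fun x hx y hy a b ha hb _ =>
      hK.add_mem _ (hK.smul_mem x hx a ha) _ (hK.smul_mem y hy b hb)
    rw [hc.closure_interior_eq_closure_of_nonempty_interior hK.solid, hK.isClosed.closure_eq]
  have hneg : closure (interior (-K)) = -K := by
    have h1 : (-K) = (Homeomorph.neg (ExtPow n 1)) ⁻¹' K := rfl
    rw [h1, ← Homeomorph.preimage_interior, ← Homeomorph.preimage_closure, hcl]
  have hset : {x₁ : Rn n | ∃ y : Fin 0 → Rn n, wedgeCons x₁ y ∈ interior K ∪ interior (-K)} =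
      h '' (interior K ∪ interior (-K)) := by
    ext x
    constructor
    · rintro ⟨y, hy⟩
      exact ⟨_, hy, by rw [he]; exact e.apply_symm_apply x⟩
    · rintro ⟨w, hw, rfl⟩
      exact ⟨Fin.elim0, by rw [he]; exact (e.symm_apply_apply w).symm ▸ hw⟩
  rw [coneT, hset, ← Homeomorph.image_closure, closure_union, hcl, hneg]
  rfl

end

/-! Let F be the set of first factors of decomposable vectors in `int K ∪ int (-K)`. It is open and
its closure is T(K), so it suffices to show that F is nonempty and that `A` maps every nonzero
vector of T(K) into F.

Nonemptiness is a Perron–Frobenius argument without eigenvectors. The operator `ε ∧ʲA` is cone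
positive, and it preserves the spanning set of decomposable vectors. If none of these lay in `int K
∪ int (-K)`, a Birkhoff-type contraction would make each of their orbits negligible against the
orbit of an interior point `u` (`exists_pow_map_le`). Negligible vectors form a subspace, so `u`
would be negligible against itself, contradicting pointedness.

For the mapping property, a limit of decomposable vectors could degenerate to 0. Gram–Schmidt
prevents this: each completion of a first factor becomes orthonormal, which only rescales the wedge.
Compactness then completes each nonzero x in T(K), up to normalization, to an orthonormal family
with wedge in `K ∪ -K`. That wedge is nonzero, so `∧ʲA` sends it into `int K ∪ int (-K)`, and A x is
a first factor. -/

open Filter Topology Module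

/-! ### Cone order and the dynamics of cone positive operators -/

section ProperCone

variable {V : Type*} [AddCommGroup V] [Module ℝ V] [TopologicalSpace V] {K : Set V}

theorem IsProperCone.zero_mem (hK : IsProperCone K) : (0 : V) ∈ K := by
  have : (0 : V) ∈ K ∩ (-K) := by rw [hK.pointed]; rfl
  exact this.1

theorem IsProperCone.smul_notMem_of_neg (hK : IsProperCone K) {x : V} (hx : x ∈ K) (h0 : x ≠ 0)
    {c : ℝ} (hc : c < 0) : c • x ∉ K := by
  intro h
  have h1 : -x ∈ K := by
    have := hK.smul_mem _ h (-c)⁻¹ (by simpa using hc.le)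
    rwa [smul_smul, inv_neg, neg_mul, inv_mul_cancel₀ hc.ne, neg_one_smul] at this
  have h2 : x ∈ K ∩ (-K) := ⟨hx, h1⟩
  rw [hK.pointed] at h2
  exact h0 h2

theorem IsConePositive.map_mem (hK : IsProperCone K) {B : V →ₗ[ℝ] V} (hB : IsConePositive K B)
    {x : V} (hx : x ∈ K) : B x ∈ K := by
  by_cases h : x = 0
  · rw [h, map_zero]; exact hK.zero_mem
  · exact interior_subset (hB ⟨x, ⟨hx, h⟩, rfl⟩)

theorem IsConePositive.pow_map_mem (hK : IsProperCone K) {B : V →ₗ[ℝ] V}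
    (hB : IsConePositive K B) {x : V} (hx : x ∈ K) (k : ℕ) : (B ^ k) x ∈ K := by
  induction k with
  | zero => simpa using hx
  | succ k ih => rw [pow_succ', Module.End.mul_apply]; exact hB.map_mem hK ih

theorem IsConePositive.pow_map_mem_interior (h0 : (0 : V) ∉ interior K)
    {B : V →ₗ[ℝ] V} (hB : IsConePositive K B) {x : V} (hx : x ∈ interior K) (k : ℕ) :
    (B ^ k) x ∈ interior K := by
  induction k with
  | zero => simpa using hx
  | succ k ih =>
    rw [pow_succ', Module.End.mul_apply]
    exact hB ⟨_, ⟨interior_subset ih, fun h => h0 (h ▸ ih)⟩, rfl⟩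

theorem IsProperCone.smul_mem_interior [ContinuousSMul ℝ V] (hK : IsProperCone K) {c : ℝ}
    (hc : 0 < c) {y : V} (hy : y ∈ interior K) : c • y ∈ interior K := by
  have h1 : (fun z => c • z) '' interior K ⊆ K := by
    rintro _ ⟨z, hz, rfl⟩
    exact hK.smul_mem z (interior_subset hz) c hc.le
  exact interior_maximal h1 (isOpenMap_smul₀ hc.ne' _ isOpen_interior) ⟨y, hy, rfl⟩

theorem mem_interior_neg_iff {G : Type*} [AddGroup G] [TopologicalSpace G] [ContinuousNeg G]
    {s : Set G} {x : G} : x ∈ interior (-s) ↔ -x ∈ interior s := by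
  have : (-s) = (Homeomorph.neg G) ⁻¹' s := rfl
  rw [this, ← Homeomorph.preimage_interior]
  rfl

variable [IsTopologicalAddGroup V]

theorem IsProperCone.add_mem_interior (hK : IsProperCone K) {x y : V} (hx : x ∈ K)
    (hy : y ∈ interior K) : x + y ∈ interior K := by
  have h1 : (fun z => x + z) '' interior K ⊆ K := by
    rintro _ ⟨z, hz, rfl⟩
    exact hK.add_mem x hx z (interior_subset hz)
  exact interior_maximal h1 (isOpenMap_add_left x _ isOpen_interior) ⟨y, hy, rfl⟩

variable [ContinuousSMul ℝ V]

theorem IsProperCone.smul_mem_interior_union_neg (hK : IsProperCone K) {c : ℝ} (hc : c ≠ 0) {x : V}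
    (hx : x ∈ interior K ∪ interior (-K)) : c • x ∈ interior K ∪ interior (-K) := by
  simp only [mem_union, mem_interior_neg_iff] at hx ⊢
  rcases lt_or_gt_of_ne hc with h | h <;> rcases hx with hx | hx
  · right; rw [← neg_smul]; exact hK.smul_mem_interior (neg_pos.2 h) hx
  · left; rw [← neg_smul_neg]; exact hK.smul_mem_interior (neg_pos.2 h) hx
  · left; exact hK.smul_mem_interior h hx
  · right; rw [← smul_neg]; exact hK.smul_mem_interior h hx

/-- An interior point is an order unit: small perturbations of `u` by `± v` stay in the cone, and
rescaling gives the bound. -/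
theorem IsProperCone.exists_smul_sub_mem (hK : IsProperCone K) {u : V} (hu : u ∈ interior K)
    (v : V) : ∃ t : ℝ, 0 < t ∧ t • u - v ∈ K ∧ t • u + v ∈ K := by
  have h1 : Continuous fun t : ℝ => u - t • v := by fun_prop
  have h2 : Continuous fun t : ℝ => u + t • v := by fun_prop
  have key : ∀ᶠ t : ℝ in 𝓝 0, u - t • v ∈ interior K ∧ u + t • v ∈ interior K :=
    (h1.continuousAt.eventually_mem (isOpen_interior.mem_nhds (by simpa using hu))).and
      (h2.continuousAt.eventually_mem (isOpen_interior.mem_nhds (by simpa using hu)))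
  obtain ⟨t, ht, ht0⟩ := ((key.filter_mono nhdsWithin_le_nhds).and
    (self_mem_nhdsWithin (s := Ioi (0 : ℝ)))).exists
  have ht0 : 0 < t := ht0
  refine ⟨t⁻¹, by positivity, ?_, ?_⟩
  · convert hK.smul_mem _ (interior_subset ht.1) t⁻¹ (by positivity) using 1
    rw [smul_sub, smul_smul, inv_mul_cancel₀ ht0.ne', one_smul]
  · convert hK.smul_mem _ (interior_subset ht.2) t⁻¹ (by positivity) using 1
    rw [smul_add, smul_smul, inv_mul_cancel₀ ht0.ne', one_smul]

/-- If 0 is an order unit, both `v` and `-v` lie in `K`. This disposes of the degenerate case of a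
zero space. -/
theorem IsProperCone.eq_zero_of_zero_mem_interior (hK : IsProperCone K)
    (h : (0 : V) ∈ interior K) (v : V) : v = 0 := by
  obtain ⟨t, -, h1, h2⟩ := hK.exists_smul_sub_mem h v
  have : v ∈ K ∩ (-K) := ⟨by simpa using h2, by simpa using h1⟩
  rwa [hK.pointed] at this

/-- A cone positive operator maps every ray of the cone into a neighbourhood of one and the same
interior ray, with uniform constants. -/
theorem IsConePositive.exists_uniform [T2Space V] [FiniteDimensional ℝ V] (hK : IsProperCone K)
    {B : V →ₗ[ℝ] V} (hB : IsConePositive K B) :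
    ∃ e ∈ K, ∃ δ : ℝ, 0 < δ ∧ ∀ x ∈ K, ∃ s : ℝ, B x - (δ * s) • e ∈ K ∧
      s • e - δ • B x ∈ K := by
  obtain ⟨e, he⟩ := hK.solid
  have hBc : Continuous B := B.continuous_of_finiteDimensional
  let φ : V ≃L[ℝ] EuclideanSpace ℝ (Fin (finrank ℝ V)) := toEuclidean
  -- `V` carries no norm, so a compact base of the cone is cut out by the unit sphere of a Euclidean
  -- model.
  have hC : IsCompact (φ.symm '' Metric.sphere 0 1 ∩ K) :=
    ((isCompact_sphere _ _).image φ.symm.continuous).inter_right hK.isClosed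
  have key : ∀ᶠ t : ℝ in 𝓝 0, ∀ x ∈ φ.symm '' Metric.sphere 0 1 ∩ K,
      B x - t • e ∈ interior K ∧ e - t • B x ∈ interior K := by
    -- At t = 0 both conditions say that `B x` and `e` are interior. They are open in (t, x), so
    -- compactness yields one δ for all x.
    refine hC.eventually_forall_of_forall_eventually fun x hx => ?_
    have hx0 : x ≠ 0 := by
      rintro rfl
      obtain ⟨⟨y, hy, hyx⟩, -⟩ := hx
      rw [map_eq_zero_iff _ φ.symm.injective] at hyx
      simp [hyx] at hy
    have h1 : Continuous fun z : ℝ × V => B z.2 - z.1 • e := by fun_prop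
    have h2 : Continuous fun z : ℝ × V => e - z.1 • B z.2 := by fun_prop
    refine (h1.continuousAt.eventually_mem (isOpen_interior.mem_nhds ?_)).and
      (h2.continuousAt.eventually_mem (isOpen_interior.mem_nhds ?_))
    · simpa using hB ⟨x, ⟨hx.2, hx0⟩, rfl⟩
    · simpa using he
  obtain ⟨δ, hδ, hδ0⟩ := ((key.filter_mono nhdsWithin_le_nhds).and
    (self_mem_nhdsWithin (s := Ioi (0 : ℝ)))).exists
  refine ⟨e, interior_subset he, δ, hδ0, fun x hx => ?_⟩
  by_cases hx0 : x = 0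
  · subst hx0
    exact ⟨0, by simpa using hK.zero_mem, by simpa using hK.zero_mem⟩
  · have hs : 0 < ‖φ x‖ := norm_pos_iff.2 (by simpa using hx0)
    have hmem : ‖φ x‖⁻¹ • x ∈ φ.symm '' Metric.sphere 0 1 ∩ K := by
      refine ⟨⟨‖φ x‖⁻¹ • φ x, ?_, by simp⟩, hK.smul_mem x hx _ (by positivity)⟩
      simp [norm_smul, hs.ne']
    obtain ⟨h1, h2⟩ := hδ _ hmem
    refine ⟨‖φ x‖, ?_, ?_⟩
    · convert hK.smul_mem _ (interior_subset h1) ‖φ x‖ hs.le using 1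
      rw [map_smul, smul_sub, smul_smul, smul_smul, mul_inv_cancel₀ hs.ne', one_smul, mul_comm]
    · convert hK.smul_mem _ (interior_subset h2) ‖φ x‖ hs.le using 1
      rw [map_smul, smul_sub, smul_smul, smul_smul, mul_right_comm, mul_inv_cancel₀ hs.ne', one_mul]

/-- In the cone order, δs e ≤ Bp ≤ (s/δ) e and δt e ≤ Bq ≤ (t/δ) e. If t ≤ s, then δ B(p + q) ≤ 2s
e, hence Bp ≥ (δ²/2) B(p + q); the other case is symmetric. -/
theorem IsConePositive.exists_contraction [T2Space V] [FiniteDimensional ℝ V]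
    (hK : IsProperCone K) {B : V →ₗ[ℝ] V} (hB : IsConePositive K B) :
    ∃ η : ℝ, 0 < η ∧ ∀ p ∈ K, ∀ q ∈ K,
      B p - η • B (p + q) ∈ K ∨ B q - η • B (p + q) ∈ K := by
  obtain ⟨e, he, δ, hδ, H⟩ := hB.exists_uniform hK
  have aux : ∀ p q : V, ∀ s t : ℝ, t ≤ s → B p - (δ * s) • e ∈ K →
      s • e - δ • B p ∈ K → t • e - δ • B q ∈ K →
      B p - (δ ^ 2 / 2) • B (p + q) ∈ K := by
    intro p q s t hts h1 h2 h3
    have h4 := hK.add_mem _ h1 _ (hK.smul_mem _ (hK.add_mem _ (hK.add_mem _ h2 _ h3) _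
      (hK.smul_mem _ he (s - t) (by linarith))) (δ / 2) (by positivity))
    convert h4 using 1
    rw [map_add]
    module
  refine ⟨δ ^ 2 / 2, by positivity, fun p hp q hq => ?_⟩
  obtain ⟨s, hs1, hs2⟩ := H p hp
  obtain ⟨t, ht1, ht2⟩ := H q hq
  rcases le_total t s with h | h
  · exact Or.inl (aux p q s t h hs1 hs2 ht2)
  · right
    rw [add_comm]
    exact aux q p t s h ht1 ht2 hs2

/-- If the orbit of `v` never enters `int K ∪ int (-K)`, then it becomes negligible compared with
the orbit of any interior point `u`. -/
theorem IsConePositive.exists_pow_map_le [T2Space V] [FiniteDimensional ℝ V]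
    (hK : IsProperCone K) (h0 : (0 : V) ∉ interior K) {B : V →ₗ[ℝ] V} (hB : IsConePositive K B)
    {u : V} (hu : u ∈ interior K) {v : V}
    (hv : ∀ k : ℕ, (B ^ k) v ∉ interior K ∪ interior (-K)) {ε : ℝ} (hε : 0 < ε) :
    ∃ k : ℕ, ε • (B ^ k) u - (B ^ k) v ∈ K ∧ ε • (B ^ k) u + (B ^ k) v ∈ K := by
  obtain ⟨η, hη, H⟩ := hB.exists_contraction hK
  have hw := fun k => hB.pow_map_mem_interior h0 hu k
  have mono : ∀ {x : V} {k l : ℕ}, (B ^ k) x ∈ K → k ≤ l → (B ^ l) x ∈ K := by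
    intro x k l hx hkl
    obtain ⟨m, rfl⟩ := Nat.exists_eq_add_of_le' hkl
    rw [pow_add, Module.End.mul_apply]
    exact hB.pow_map_mem hK hx m
  -- Lower and upper bounds for the orbit of `v` in units of the orbit of `u`. By `mono`, a bound
  -- persists once it is attained.
  let lo : Set ℝ := {t | ∃ k : ℕ, (B ^ k) (v - t • u) ∈ K}
  let up : Set ℝ := {t | ∃ k : ℕ, (B ^ k) (t • u - v) ∈ K}
  obtain ⟨t, -, ht1, ht2⟩ := hK.exists_smul_sub_mem hu v
  have hlo : lo.Nonempty := ⟨-t, 0, by simpa [add_comm] using ht2⟩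
  have hup : up.Nonempty := ⟨t, 0, by simpa using ht1⟩
  have hlo0 : ∀ t ∈ lo, t ≤ 0 := by
    rintro t ⟨k, hk⟩
    by_contra! h
    refine hv k (Or.inl ?_)
    have := hK.add_mem_interior hk (hK.smul_mem_interior h (hw k))
    rwa [map_sub, map_smul, sub_add_cancel] at this
  have hup0 : ∀ t ∈ up, 0 ≤ t := by
    rintro t ⟨k, hk⟩
    by_contra! h
    refine hv k (Or.inr (mem_interior_neg_iff.2 ?_))
    have := hK.add_mem_interior hk (hK.smul_mem_interior (neg_pos.2 h) (hw k))
    rw [map_sub, map_smul] at this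
    convert this using 1
    module
  have bdlo : BddAbove lo := ⟨0, hlo0⟩
  have bdup : BddBelow up := ⟨0, hup0⟩
  have hc : sSup lo ≤ 0 := csSup_le hlo hlo0
  have hd : 0 ≤ sInf up := le_csInf hup hup0
  -- A gap is impossible: for bounds m and M within η times the gap of the extremes, the contraction
  -- improves one of them by η(M - m), past its extreme. So both extremes are 0.
  have hcd : sInf up ≤ sSup lo := by
    by_contra! hlt
    have hr : 0 < η * (sInf up - sSup lo) := mul_pos hη (sub_pos.2 hlt)
    obtain ⟨m, ⟨k, hk⟩, hm⟩ := exists_lt_of_lt_csSup hlo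
      (sub_lt_self (sSup lo) hr)
    obtain ⟨M, ⟨l, hl⟩, hM⟩ := exists_lt_of_csInf_lt hup
      (lt_add_of_pos_right (sInf up) hr)
    have hm' : m ≤ sSup lo := le_csSup bdlo ⟨k, hk⟩
    have hM' : sInf up ≤ M := csInf_le bdup ⟨l, hl⟩
    have hge : η * (sInf up - sSup lo) ≤ η * (M - m) := by gcongr
    have e1 : ∀ j : ℕ, (B ^ j) (v - m • u) + (B ^ j) (M • u - v) = (M - m) • (B ^ j) u := by
      intro j; simp only [map_sub, map_smul]; module
    rcases H _ (mono hk (le_max_left k l)) _ (mono hl (le_max_right k l)) with h | h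
    · have : m + η * (M - m) ∈ lo := by
        refine ⟨max k l + 1, ?_⟩
        rw [e1, map_smul] at h
        rw [pow_succ', Module.End.mul_apply]
        convert h using 1
        simp only [map_sub, map_smul]
        module
      linarith [le_csSup bdlo this]
    · have : M - η * (M - m) ∈ up := by
        refine ⟨max k l + 1, ?_⟩
        rw [e1, map_smul] at h
        rw [pow_succ', Module.End.mul_apply]
        convert h using 1
        simp only [map_sub, map_smul]
        module
      linarith [csInf_le bdup this]
  obtain ⟨m, ⟨k, hk⟩, hm⟩ := exists_lt_of_lt_csSup hlo (show -ε < sSup lo by linarith)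
  obtain ⟨M, ⟨l, hl⟩, hM⟩ := exists_lt_of_csInf_lt hup (show sInf up < ε by linarith)
  have hk' := mono hk (le_max_left k l)
  have hl' := mono hl (le_max_right k l)
  have hw' := interior_subset (hw (max k l))
  refine ⟨max k l, ?_, ?_⟩
  · convert hK.add_mem _ hl' _ (hK.smul_mem _ hw' (ε - M) (by linarith)) using 1
    simp only [map_sub, map_smul]
    module
  · convert hK.add_mem _ hk' _ (hK.smul_mem _ hw' (ε + m) (by linarith)) using 1
    simp only [map_sub, map_smul]
    module

/-- A spanning set that is invariant under a cone positive operator meets `int K ∪ int (-K)`. -/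
theorem IsConePositive.exists_mem_interior_union_neg [T2Space V] [FiniteDimensional ℝ V]
    (hK : IsProperCone K) (h0 : (0 : V) ∉ interior K) {B : V →ₗ[ℝ] V} (hB : IsConePositive K B)
    {S : Set V} (hS : Submodule.span ℝ S = ⊤) (hBS : MapsTo B S S) :
    ∃ s ∈ S, s ∈ interior K ∪ interior (-K) := by
  by_contra! hno
  obtain ⟨u, hu⟩ := hK.solid
  have hw := fun k => hB.pow_map_mem_interior h0 hu k
  have hstep : ∀ (x : V) (k l : ℕ), (B ^ k) x ∈ K → (B ^ (l + k)) x ∈ K := by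
    intro x k l hx
    rw [pow_add, Module.End.mul_apply]
    exact hB.pow_map_mem hK hx l
  let N : Submodule ℝ V :=
    { carrier := {v | ∀ ε : ℝ, 0 < ε → ∃ k : ℕ, (B ^ k) (ε • u - v) ∈ K ∧ (B ^ k) (ε • u + v) ∈ K}
      zero_mem' := fun ε hε => ⟨0, by
        simpa using hK.smul_mem _ (interior_subset hu) ε hε.le⟩
      add_mem' := by
        intro x y hx hy ε hε
        obtain ⟨k, hk1, hk2⟩ := hx (ε / 2) (by positivity)
        obtain ⟨l, hl1, hl2⟩ := hy (ε / 2) (by positivity)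
        refine ⟨l + k, ?_, ?_⟩
        · have h := hK.add_mem _ (hstep _ _ l hk1) _ (add_comm l k ▸ hstep _ _ k hl1)
          rw [← map_add] at h
          convert h using 2
          module
        · have h := hK.add_mem _ (hstep _ _ l hk2) _ (add_comm l k ▸ hstep _ _ k hl2)
          rw [← map_add] at h
          convert h using 2
          module
      smul_mem' := by
        intro c x hx ε hε
        obtain ⟨k, hk1, hk2⟩ := hx (ε / (|c| + 1)) (by positivity)
        have hu' : (B ^ k) u ∈ K := interior_subset (hw k)
        have hc : 0 < |c| + 1 := by positivity
        -- With C = |c| + 1 and δ = ε / C, εu ∓ cx is the combination of δu ∓ x and δu ± x with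
        -- weights (C + c)/2 and (C - c)/2, both nonnegative.
        have h1 := hK.smul_mem _ hk1 ((|c| + 1 + c) / 2) (by linarith [neg_abs_le c])
        have h2 := hK.smul_mem _ hk2 ((|c| + 1 - c) / 2) (by linarith [le_abs_self c])
        have h3 := hK.smul_mem _ hk2 ((|c| + 1 + c) / 2) (by linarith [neg_abs_le c])
        have h4 := hK.smul_mem _ hk1 ((|c| + 1 - c) / 2) (by linarith [le_abs_self c])
        refine ⟨k, ?_, ?_⟩
        · convert hK.add_mem _ h1 _ h2 using 1
          simp only [map_sub, map_add, map_smul]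
          match_scalars <;> field_simp <;> ring
        · convert hK.add_mem _ h3 _ h4 using 1
          simp only [map_sub, map_add, map_smul]
          match_scalars <;> field_simp <;> ring }
  have hSN : S ⊆ N := by
    intro s hs ε hε
    have hs' : ∀ k : ℕ, (B ^ k) s ∈ S := by
      intro k
      rw [Module.End.pow_apply]
      exact hBS.iterate k hs
    obtain ⟨k, h1, h2⟩ := hB.exists_pow_map_le hK h0 hu (fun k => hno _ (hs' k)) hε
    exact ⟨k, by simpa using h1, by simpa using h2⟩
  have huN : u ∈ N := by
    have : N = ⊤ := top_le_iff.1 (hS ▸ Submodule.span_le.2 hSN)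
    rw [this]
    trivial
  -- Any ε < 1 would do: it puts a negative multiple of the interior point `(B ^ k) u` into `K`.
  obtain ⟨k, h1, -⟩ := huN (1 / 2) (by norm_num)
  refine hK.smul_notMem_of_neg (interior_subset (hw k)) (fun h => h0 (h ▸ hw k))
    (show (-1 / 2 : ℝ) < 0 by norm_num) ?_
  convert h1 using 1
  rw [map_sub, map_smul]
  module

end ProperCone

/-! ### Multilinear algebra and compactness of orthonormal families -/

/-- In a basis, `f` is a finite sum of products of coordinates times constant vectors, so no norm on
`F` is needed. -/
theorem MultilinearMap.continuous_of_finiteDimensional_domain {ι E F : Type*} [Finite ι]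
    [NormedAddCommGroup E] [NormedSpace ℝ E] [FiniteDimensional ℝ E] [AddCommGroup F] [Module ℝ F]
    [TopologicalSpace F] [ContinuousAdd F] [ContinuousSMul ℝ F]
    (f : MultilinearMap ℝ (fun _ : ι => E) F) : Continuous f := by
  classical
  have := Fintype.ofFinite ι
  let b := finBasis ℝ E
  have hb : ∀ i, Continuous (b.coord i) := fun i => (b.coord i).continuous_of_finiteDimensional
  have hf : (f : (ι → E) → F) = fun v => ∑ r : ι → Fin (finrank ℝ E),
      (∏ i, b.coord (r i) (v i)) • f fun i => b (r i) := by
    ext v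
    conv_lhs => rw [show v = fun i => ∑ j, b.coord j (v i) • b j from
      funext fun i => (b.sum_repr (v i)).symm]
    rw [f.map_sum]
    exact Finset.sum_congr rfl fun r _ => f.map_smul_univ _ _
  rw [hf]
  refine continuous_finsetSum _ fun r _ => Continuous.smul ?_ continuous_const
  exact continuous_finsetProd _ fun i _ => (hb _).comp (continuous_apply i)

/-- On the m-dimensional span of `g`, an alternating m-linear map is determined by its value on the
basis `g`; the scalar is the determinant of `v` in that basis. -/
theorem AlternatingMap.exists_eq_smul_of_span_le {m : ℕ} {E F : Type*} [AddCommGroup E]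
    [Module ℝ E] [AddCommGroup F] [Module ℝ F] (f : E [⋀^Fin m]→ₗ[ℝ] F) {g v : Fin m → E}
    (hg : LinearIndependent ℝ g) (hv : ∀ i, v i ∈ Submodule.span ℝ (range g)) :
    ∃ c : ℝ, f v = c • f g := by
  let b := Basis.span hg
  have hb : ∀ i, (b i : E) = g i := fun i => by rw [Basis.span_apply hg]
  let F₁ := f.compLinearMap (Submodule.span ℝ (range g)).subtype
  let F₂ := (LinearMap.toSpanSingleton ℝ F (f g)).compAlternatingMap b.det
  have hF : F₁ = F₂ := by
    refine b.ext_alternating fun σ hσ => ?_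
    let τ : Equiv.Perm (Fin m) := Equiv.ofBijective σ (Finite.injective_iff_bijective.1 hσ)
    change F₁ (b ∘ τ) = F₂ (b ∘ τ)
    rw [F₁.map_perm, F₂.map_perm]
    congr 1
    simp only [F₁, F₂, AlternatingMap.compLinearMap_apply, LinearMap.compAlternatingMap_apply,
      b.det_self, LinearMap.toSpanSingleton_apply, one_smul]
    congr 1
    exact funext hb
  have h : F₁ (fun i => ⟨v i, hv i⟩) = F₂ (fun i => ⟨v i, hv i⟩) := by rw [hF]
  exact ⟨b.det fun i => ⟨v i, hv i⟩, h⟩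

theorem isCompact_setOf_orthonormal {ι E : Type*} [Fintype ι] [NormedAddCommGroup E]
    [InnerProductSpace ℝ E] [FiniteDimensional ℝ E] :
    IsCompact {g : ι → E | Orthonormal ℝ g} := by
  classical
  have : ProperSpace E := FiniteDimensional.proper_real E
  refine (isCompact_closedBall (0 : ι → E) 1).of_isClosed_subset ?_ fun g hg => ?_
  · simp only [orthonormal_iff_ite, ofPred_forall]
    exact isClosed_iInter fun i => isClosed_iInter fun j =>
      isClosed_eq (by fun_prop) continuous_const
  · rw [mem_closedBall_zero_iff, pi_norm_le_iff_of_nonneg zero_le_one]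
    exact fun i => (hg.1 i).le

instance ExtPow.t2Space (n j : ℕ) : T2Space (ExtPow n j) :=
  T2Space.of_injective_continuous (finBasis ℝ (ExtPow n j)).equivFun.injective
    (IsModuleTopology.continuous_of_linearMap
      (finBasis ℝ (ExtPow n j)).equivFun.toLinearMap)

theorem continuous_ιMulti (n j : ℕ) :
    Continuous (exteriorPower.ιMulti ℝ j : (Fin j → Rn n) → ExtPow n j) :=
  (exteriorPower.ιMulti ℝ j (M := Rn n)).toMultilinearMap.continuous_of_finiteDimensional_domain

/-! ### First factors and the set T(K) -/

section ConeT

variable {n k : ℕ} {K : Set (ExtPow n (k + 1))}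

/-- The set of first factors of the decomposable vectors in `int K ∪ int (-K)`. -/
def firstFactors (K : Set (ExtPow n (k + 1))) : Set (Rn n) :=
  {x | ∃ y : Fin k → Rn n, wedgeCons x y ∈ interior K ∪ interior (-K)}

theorem isOpen_firstFactors : IsOpen (firstFactors K) := by
  have : firstFactors K = ⋃ y : Fin k → Rn n,
      (fun x => wedgeCons x y) ⁻¹' (interior K ∪ interior (-K)) := by
    ext x; simp [firstFactors]
  rw [this]
  refine isOpen_iUnion fun y => (isOpen_interior.union isOpen_interior).preimage ?_
  exact (continuous_ιMulti n (k + 1)).comp (by fun_prop)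

theorem firstFactors_subset_interior_coneT : firstFactors K ⊆ interior (coneT K) :=
  interior_maximal subset_closure isOpen_firstFactors

theorem mem_firstFactors_of_ιMulti_mem {f : Fin (k + 1) → Rn n}
    (hf : exteriorPower.ιMulti ℝ (k + 1) f ∈ interior K ∪ interior (-K)) :
    f 0 ∈ firstFactors K :=
  ⟨Fin.tail f, by rwa [wedgeCons, Fin.cons_self_tail]⟩

theorem ιMulti_map_mem {A : Rn n →ₗ[ℝ] Rn n} (hK : IsProperCone K) {ε : ℝ} (hε : ε ≠ 0)
    (hA : IsConePositive K (ε • exteriorPower.map (k + 1) A)) {f : Fin (k + 1) → Rn n}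
    (hf : exteriorPower.ιMulti ℝ (k + 1) f ∈ K ∪ -K) (hf0 : exteriorPower.ιMulti ℝ (k + 1) f ≠ 0) :
    exteriorPower.ιMulti ℝ (k + 1) (A ∘ f) ∈ interior K ∪ interior (-K) := by
  have h : ε • exteriorPower.ιMulti ℝ (k + 1) (A ∘ f) ∈ interior K ∪ interior (-K) := by
    rw [← exteriorPower.map_apply_ιMulti]
    rcases hf with hf | hf
    · exact Or.inl (hA ⟨_, ⟨hf, hf0⟩, rfl⟩)
    · refine Or.inr (mem_interior_neg_iff.2 (hA ⟨_, ⟨hf, by simpa using hf0⟩, ?_⟩))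
      rw [map_neg]; rfl
  have := hK.smul_mem_interior_union_neg (inv_ne_zero hε) h
  rwa [smul_smul, inv_mul_cancel₀ hε, one_smul] at this

theorem firstFactors_nonempty {A : Rn n →ₗ[ℝ] Rn n} (hK : IsProperCone K) {ε : ℝ}
    (hA : IsConePositive K (ε • exteriorPower.map (k + 1) A)) :
    (firstFactors K).Nonempty := by
  by_cases h0 : (0 : ExtPow n (k + 1)) ∈ interior K
  · exact ⟨0, 0, Or.inl (by rwa [hK.eq_zero_of_zero_mem_interior h0 (wedgeCons _ _)])⟩
  have hS : Submodule.span ℝ (range (exteriorPower.ιMulti ℝ (k + 1) (M := Rn n))) = ⊤ :=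
    exteriorPower.ιMulti_span ℝ (k + 1) (Rn n)
  have hBS : MapsTo (ε • exteriorPower.map (k + 1) A)
      (range (exteriorPower.ιMulti ℝ (k + 1) (M := Rn n)))
      (range (exteriorPower.ιMulti ℝ (k + 1) (M := Rn n))) := by
    rintro _ ⟨f, rfl⟩
    -- Absorbing `ε` into one factor keeps the image decomposable.
    refine ⟨Function.update (A ∘ f) 0 (ε • (A ∘ f) 0), ?_⟩
    rw [AlternatingMap.map_update_smul, Function.update_eq_self, LinearMap.smul_apply,
      exteriorPower.map_apply_ιMulti]
  obtain ⟨_, ⟨f, rfl⟩, hf⟩ := hA.exists_mem_interior_union_neg hK h0 hS hBS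
  exact ⟨_, mem_firstFactors_of_ιMulti_mem hf⟩

open InnerProductSpace in
/-- A first factor can be completed by an orthonormal family. -/
theorem exists_orthonormal_of_mem_firstFactors (hK : IsProperCone K)
    (h0 : (0 : ExtPow n (k + 1)) ∉ interior K) {x : Rn n} (hx : x ∈ firstFactors K) :
    ∃ g : Fin (k + 1) → Rn n, Orthonormal ℝ g ∧ g 0 = ‖x‖⁻¹ • x ∧
      exteriorPower.ιMulti ℝ (k + 1) g ∈ K ∪ -K := by
  obtain ⟨y, hy⟩ := hx
  set f : Fin (k + 1) → Rn n := Fin.cons x y with hf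
  have hy0 : exteriorPower.ιMulti ℝ (k + 1) f ≠ 0 := by
    intro h
    rw [wedgeCons, h, mem_union, mem_interior_neg_iff, neg_zero, or_self] at hy
    exact h0 hy
  have hli : LinearIndependent ℝ f := by
    by_contra h
    exact hy0 (AlternatingMap.map_linearDependent _ _ h)
  obtain ⟨c, hc⟩ := (exteriorPower.ιMulti ℝ (k + 1) (M := Rn n)).exists_eq_smul_of_span_le
    -- Gram–Schmidt preserves the span, so the old wedge is a multiple of the orthonormal one, and
    -- it fixes the first vector up to normalization.
    (gramSchmidtNormed_linearIndependent hli) (v := f) fun i => by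
      rw [span_gramSchmidtNormed_range, span_gramSchmidt]
      exact Submodule.subset_span (mem_range_self i)
  have hc0 : c ≠ 0 := by
    rintro rfl
    exact hy0 (by rw [hc, zero_smul])
  refine ⟨_, gramSchmidtNormed_orthonormal hli, ?_, ?_⟩
  · have : gramSchmidt ℝ f 0 = x := gramSchmidt_bot ℝ f
    rw [gramSchmidtNormed, this]
    rfl
  · rw [wedgeCons, ← hf, hc] at hy
    have := hK.smul_mem_interior_union_neg (inv_ne_zero hc0) hy
    rw [smul_smul, inv_mul_cancel₀ hc0, one_smul] at this
    exact union_subset_union interior_subset interior_subset this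

/-- Orthonormal families with wedge in `K ∪ -K` form a compact set, so their first vectors form a
closed set. It contains the normalized first factors, and normalization is continuous at `x ≠ 0`. -/
theorem exists_orthonormal_of_mem_coneT (hK : IsProperCone K)
    (h0 : (0 : ExtPow n (k + 1)) ∉ interior K) {x : Rn n} (hx : x ∈ coneT K) (hx0 : x ≠ 0) :
    ∃ g : Fin (k + 1) → Rn n, Orthonormal ℝ g ∧ g 0 = ‖x‖⁻¹ • x ∧
      exteriorPower.ιMulti ℝ (k + 1) g ∈ K ∪ -K := by
  let C : Set (Fin (k + 1) → Rn n) :=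
    {g | Orthonormal ℝ g} ∩ exteriorPower.ιMulti ℝ (k + 1) ⁻¹' (K ∪ -K)
  have hC : IsCompact C := isCompact_setOf_orthonormal.inter_right
    ((hK.isClosed.union hK.isClosed.neg).preimage (continuous_ιMulti n (k + 1)))
  have hD : IsClosed ((fun g => g 0) '' C) := (hC.image (continuous_apply 0)).isClosed
  have hcont : ContinuousAt (fun z : Rn n => ‖z‖⁻¹ • z) x :=
    (continuousAt_id.norm.inv₀ (norm_ne_zero_iff.2 hx0)).smul continuousAt_id
  have hmem : ‖x‖⁻¹ • x ∈ (fun g => g 0) '' C := by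
    rw [← hD.closure_eq]
    refine closure_mono ?_ (hcont.continuousWithinAt.mem_closure_image hx)
    rintro _ ⟨z, hz, rfl⟩
    obtain ⟨g, hg, hg0, hgK⟩ := exists_orthonormal_of_mem_firstFactors hK h0 hz
    exact ⟨g, ⟨hg, hgK⟩, hg0⟩
  obtain ⟨g, ⟨hg, hgK⟩, hg0⟩ := hmem
  exact ⟨g, hg, hg0, hgK⟩

theorem ιMulti_ne_zero_of_linearIndependent {m : ℕ} {E : Type*} [AddCommGroup E] [Module ℝ E]
    {g : Fin m → E} (hg : LinearIndependent ℝ g) : exteriorPower.ιMulti ℝ m g ≠ 0 := by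
  -- The wedge of `g` is the member, indexed by the full subset of `Fin m`, of a linearly
  -- independent family.
  have h := (exteriorPower.ιMulti_family_linearIndependent_field (n := m) hg).ne_zero
    (Set.powersetCard.ofFinEmbEquiv (OrderIso.refl (Fin m)).toOrderEmbedding)
  rwa [exteriorPower.ιMulti_family, Equiv.symm_apply_apply] at h

theorem map_mem_firstFactors {A : Rn n →ₗ[ℝ] Rn n} (hK : IsProperCone K) {ε : ℝ} (hε : ε ≠ 0)
    (hA : IsConePositive K (ε • exteriorPower.map (k + 1) A)) {x : Rn n} (hx : x ∈ coneT K)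
    (hx0 : x ≠ 0) : A x ∈ firstFactors K := by
  by_cases h0 : (0 : ExtPow n (k + 1)) ∈ interior K
  · exact ⟨0, Or.inl (by rwa [hK.eq_zero_of_zero_mem_interior h0 (wedgeCons _ _)])⟩
  obtain ⟨g, hg, hg0, hgK⟩ := exists_orthonormal_of_mem_coneT hK h0 hx hx0
  have hAg := ιMulti_map_mem hK hε hA hgK
    (ιMulti_ne_zero_of_linearIndependent hg.linearIndependent)
  have hn : ‖x‖ ≠ 0 := norm_ne_zero_iff.2 hx0
  -- Multiplying by `‖x‖` in the first slot undoes the normalization, turning A(x/‖x‖) into A x.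
  have h1 := hK.smul_mem_interior_union_neg hn hAg
  have h2 := AlternatingMap.map_update_smul (exteriorPower.ιMulti ℝ (k + 1)) (A ∘ g) 0 ‖x‖
    ((A ∘ g) 0)
  rw [Function.update_eq_self] at h2
  rw [← h2] at h1
  have h3 := mem_firstFactors_of_ιMulti_mem h1
  rwa [Function.update_self, Function.comp_apply, hg0, map_smul, smul_smul,
    mul_inv_cancel₀ hn, one_smul] at h3

end ConeT

theorem theorem25 (n : ℕ) (K : TotallyPositiveStructure n) (A : Rn n →ₗ[ℝ] Rn n)
    (hA : IsGSSR K A) (i : Fin n) :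
    (interior (coneT (K.cone i))).Nonempty ∧
      A '' (coneT (K.cone i) \ {0}) ⊆ interior (coneT (K.cone i)) := by
  obtain ⟨ε, hε, hA⟩ := hA
  have hεi : ε i ≠ 0 := by rcases hε i with h | h <;> rw [h] <;> norm_num
  refine ⟨(firstFactors_nonempty (K.proper i) (hA i)).mono firstFactors_subset_interior_coneT, ?_⟩
  rintro _ ⟨x, ⟨hx, hx0⟩, rfl⟩
  exact firstFactors_subset_interior_coneT (map_mem_firstFactors (K.proper i) hεi (hA i) hx hx0)
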